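/- Let $(M,g)$ be a smooth (not necessarily complete) semi-Riemannian manifold and let $\epsilon\in\{1,-1\}$. Let $\widehat M=\mathbb{R}_{>0}\times M$ be equipped with the cone metric $\widehat g=\epsilon\,dr^2+r^2g$, where $r$ is the coordinate on $\mathbb{R}_{>0}$, and write $\partial_r$ for the radial vector field. Let $V$ be a smooth vector field on $\widehat M$ that is parallel for the Levi-Civita connection $\widehat\nabla$ of $\widehat g$, i.e. $\widehat\nabla V=0$. Then the function $\widehat g(V,\partial_r)$ does not depend on $r$: there is a smooth function $u\in C^\infty(M)$ with $\widehat g(V,\partial_r)_{(r,p)}=u(p)$ for all $(r,p)\in\widehat M$. Moreover, at every $(r,p)\in\widehat M$, $$V=\epsilon\,u\,\partial_r+\frac1r\,\nabla u,$$ where $\nabla u$ is the gradient of $u$ with respect to $g$, regarded as a vector tangent to $\{r\}\times M$, and $u$ satisfies $$\nabla du=-\epsilon\,u\,g \quad\text{on } M,$$ where $\nabla$ is the Levi-Civita connection of $g$ and $(\nabla du)(X,Y)=X(du(Y))-du(\nabla_XY)$. -/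

import Mathlib

open Bundle
open scoped Manifold ContDiff

noncomputable section

set_option linter.unusedSectionVars false

section General

variable {E : Type*} [NormedAddCommGroup E] [NormedSpace ℝ E]
  {H : Type*} [TopologicalSpace H] (I : ModelWithCorners ℝ E H)
  (M : Type*) [TopologicalSpace M] [ChartedSpace H M]

/-- A smooth semi-Riemannian metric on `M`: a smooth family of symmetric nondegenerate bilinear
forms on the tangent spaces. -/
structure SemiRiemannianMetric [IsManifold I ∞ M] where
  inner (x : M) : TangentSpace I x →L[ℝ] TangentSpace I x →L[ℝ] ℝ
  symm (x : M) (v w : TangentSpace I x) : inner x v w = inner x w v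
  nondegenerate (x : M) (v : TangentSpace I x) (hv : ∀ w, inner x v w = 0) : v = 0
  contMDiff : ContMDiff I (I.prod 𝓘(ℝ, E →L[ℝ] E →L[ℝ] ℝ)) ∞
    (fun x ↦ TotalSpace.mk' (E →L[ℝ] E →L[ℝ] ℝ)
      (E := fun x : M ↦ TangentSpace I x →L[ℝ] TangentSpace I x →L[ℝ] ℝ) x (inner x))

variable {M} in
/-- Components of a tangent vector at `y` in the coordinate frame of the preferred chart at `x`. -/
def coordVec [IsManifold I ∞ M] (x y : M) : TangentSpace I y →L[ℝ] E :=
  (trivializationAt E (TangentSpace I) x).continuousLinearMapAt ℝ y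

variable {M} in
/-- The tangent vector at `y` with given components in the coordinate frame of the preferred chart
at `x`. -/
def ofCoordVec [IsManifold I ∞ M] (x y : M) : E →L[ℝ] TangentSpace I y :=
  (trivializationAt E (TangentSpace I) x).symmL ℝ y

variable {I M} in
/-- The components of a bilinear form on the tangent space at `y` in the coordinate frame of the
preferred chart at `x`. -/
def coordForm [IsManifold I ∞ M] (x : M) {y : M}
    (b : TangentSpace I y →L[ℝ] TangentSpace I y →L[ℝ] ℝ) : E →L[ℝ] E →L[ℝ] ℝ :=
  (ofCoordVec I x y).precomp ℝ ∘L b ∘L ofCoordVec I x y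

variable {I M} in
lemma inCoordinates_eq_coordForm [IsManifold I ∞ M] {x y : M}
    (hy : y ∈ (trivializationAt E (TangentSpace I) x).baseSet)
    (b : TangentSpace I y →L[ℝ] TangentSpace I y →L[ℝ] ℝ) :
    ContinuousLinearMap.inCoordinates E (TangentSpace I) (E →L[ℝ] ℝ)
      (fun y : M ↦ TangentSpace I y →L[ℝ] ℝ) x y x y b = coordForm x b := by
  have hy' : y ∈ (trivializationAt (E →L[ℝ] ℝ)
      (fun y : M ↦ TangentSpace I y →L[ℝ] ℝ) x).baseSet := by
    rw [hom_trivializationAt_baseSet]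
    exact ⟨hy, trivial⟩
  ext e e'
  rw [ContinuousLinearMap.inCoordinates, ContinuousLinearMap.comp_apply,
    ContinuousLinearMap.comp_apply, Trivialization.continuousLinearMapAt_apply,
    Trivialization.linearMapAt_apply, if_pos hy', hom_trivializationAt_apply,
    ContinuousLinearMap.inCoordinates]
  simp [coordForm, ofCoordVec]

variable {I M} in
lemma contMDiff_form_iff [IsManifold I ∞ M]
    (b : Π x : M, TangentSpace I x →L[ℝ] TangentSpace I x →L[ℝ] ℝ) (x : M) :
    ContMDiffAt I (I.prod 𝓘(ℝ, E →L[ℝ] E →L[ℝ] ℝ)) ∞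
      (fun x ↦ TotalSpace.mk' (E →L[ℝ] E →L[ℝ] ℝ)
        (E := fun x : M ↦ TangentSpace I x →L[ℝ] TangentSpace I x →L[ℝ] ℝ) x (b x)) x ↔
    ContMDiffAt I 𝓘(ℝ, E →L[ℝ] E →L[ℝ] ℝ) ∞ (fun y ↦ coordForm x (b y)) x := by
  rw [contMDiffAt_hom_bundle]
  have : (fun y ↦ ContinuousLinearMap.inCoordinates E (TangentSpace I) (E →L[ℝ] ℝ)
      (fun y : M ↦ TangentSpace I y →L[ℝ] ℝ) x y x y (b y)) =ᶠ[nhds x]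
      (fun y ↦ coordForm x (b y)) := by
    filter_upwards [(trivializationAt E (TangentSpace I) x).open_baseSet.mem_nhds
      (FiberBundle.mem_baseSet_trivializationAt' x)] with y hy
    exact inCoordinates_eq_coordForm hy (b y)
  constructor
  · exact fun h ↦ h.2.congr_of_eventuallyEq this.symm
  · exact fun h ↦ ⟨contMDiffAt_id, h.congr_of_eventuallyEq this⟩

section pullback
variable {I M} {E' : Type*} [NormedAddCommGroup E'] [NormedSpace ℝ E']
  {H' : Type*} [TopologicalSpace H'] {I' : ModelWithCorners ℝ E' H'}
  {N : Type*} [TopologicalSpace N] [ChartedSpace H' N]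

lemma contMDiff_pullback_form [IsManifold I ∞ M] [IsManifold I' ∞ N]
    (b : Π x : M, TangentSpace I x →L[ℝ] TangentSpace I x →L[ℝ] ℝ)
    (hb : ContMDiff I (I.prod 𝓘(ℝ, E →L[ℝ] E →L[ℝ] ℝ)) ∞
      (fun x ↦ TotalSpace.mk' (E →L[ℝ] E →L[ℝ] ℝ)
        (E := fun x : M ↦ TangentSpace I x →L[ℝ] TangentSpace I x →L[ℝ] ℝ) x (b x)))
    {f : N → M} (hf : ContMDiff I' I ∞ f) :
    ContMDiff I' (I'.prod 𝓘(ℝ, E' →L[ℝ] E' →L[ℝ] ℝ)) ∞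
      (fun q ↦ TotalSpace.mk' (E' →L[ℝ] E' →L[ℝ] ℝ)
        (E := fun q : N ↦ TangentSpace I' q →L[ℝ] TangentSpace I' q →L[ℝ] ℝ) q
        ((mfderiv I' I f q).precomp ℝ ∘L b (f q) ∘L mfderiv I' I f q)) := by
  intro q
  rw [contMDiff_form_iff]
  have h1 := ((contMDiff_form_iff b (f q)).1 (hb (f q))).comp q (hf q)
  have h2 := (hf q).mfderiv_const (m := ∞) (by simp)
  have h3 := (h2.clm_precomp (F₃ := ℝ)).clm_comp (h1.clm_comp h2)
  refine h3.congr_of_eventuallyEq ?_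
  filter_upwards [(trivializationAt E' (TangentSpace I') q).open_baseSet.mem_nhds
      (FiberBundle.mem_baseSet_trivializationAt' q),
      hf.continuous.continuousAt.preimage_mem_nhds
       ((trivializationAt E (TangentSpace I) (f q)).open_baseSet.mem_nhds
      (FiberBundle.mem_baseSet_trivializationAt' (f q)))] with p hp hp'
  ext e e'
  have key : ∀ e, ofCoordVec I (f q) (f p) (inTangentCoordinates I' I id f
      (fun p ↦ mfderiv I' I f p) q p e) = mfderiv I' I f p (ofCoordVec I' q p e) := by
    intro e
    exact (trivializationAt E (TangentSpace I) (f q)).symmL_continuousLinearMapAt hp' _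
  change b (f p) (mfderiv I' I f p (ofCoordVec I' q p e))
     (mfderiv I' I f p (ofCoordVec I' q p e')) = b (f p) (ofCoordVec I (f q) (f p) (inTangentCoordinates I' I id f
      (fun p ↦ mfderiv I' I f p) q p e)) (ofCoordVec I (f q) (f p) (inTangentCoordinates I' I id f
      (fun p ↦ mfderiv I' I f p) q p e'))
  rw [key, key]

end pullback

namespace SemiRiemannianMetric

variable {I M} [IsManifold I ∞ M] [FiniteDimensional ℝ E] (g : SemiRiemannianMetric I M)

instance tangentSpaceFiniteDimensional (x : M) : FiniteDimensional ℝ (TangentSpace I x) :=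
  inferInstanceAs (FiniteDimensional ℝ E)

instance tangentSpaceT2 (x : M) : T2Space (TangentSpace I x) :=
  inferInstanceAs (T2Space E)

/-- The isomorphism `v ↦ g(v, ·)` from tangent to cotangent vectors. -/
def flat (x : M) : TangentSpace I x ≃ₗ[ℝ] Module.Dual ℝ (TangentSpace I x) :=
  (ContinuousLinearMap.coeLM ℝ ∘ₗ (g.inner x).toLinearMap).linearEquivOfInjective
    ((injective_iff_map_eq_zero _).2 fun v hv ↦
      g.nondegenerate x v fun w ↦ LinearMap.congr_fun hv w)
    Subspace.dual_finrank_eq.symm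

lemma inner_flat_symm (x : M) (α : Module.Dual ℝ (TangentSpace I x)) (w : TangentSpace I x) :
    g.inner x ((g.flat x).symm α) w = α w :=
  LinearMap.congr_fun ((g.flat x).apply_symm_apply α) w

/-- The matrix `g_{ij}` at `y` of the metric, in the chart at `x`. -/
def coord (x y : M) : E →L[ℝ] E →L[ℝ] ℝ :=
  coordForm x (g.inner y)

/-- The coordinate derivative `∂_v g(w, z)` at `x` of the metric in the chart at `x`. -/
def dCoord (x : M) (v w z : TangentSpace I x) : ℝ :=
  mvfderiv I (g.coord x) x v (coordVec I x x w) (coordVec I x x z)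

lemma dCoord_add₁ (x : M) (v v' w z : TangentSpace I x) :
    g.dCoord x (v + v') w z = g.dCoord x v w z + g.dCoord x v' w z := by
  rw [dCoord, ContinuousLinearMap.map_add]
  rfl

lemma dCoord_add₂ (x : M) (v w w' z : TangentSpace I x) :
    g.dCoord x v (w + w') z = g.dCoord x v w z + g.dCoord x v w' z := by
  rw [dCoord, ContinuousLinearMap.map_add, ContinuousLinearMap.map_add]
  rfl

lemma dCoord_add₃ (x : M) (v w z z' : TangentSpace I x) :
    g.dCoord x v w (z + z') = g.dCoord x v w z + g.dCoord x v w z' := by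
  rw [dCoord, ContinuousLinearMap.map_add, ContinuousLinearMap.map_add]
  rfl

lemma dCoord_smul₁ (x : M) (c : ℝ) (v w z : TangentSpace I x) :
    g.dCoord x (c • v) w z = c * g.dCoord x v w z := by
  rw [dCoord, ContinuousLinearMap.map_smul]
  rfl

lemma dCoord_smul₂ (x : M) (c : ℝ) (v w z : TangentSpace I x) :
    g.dCoord x v (c • w) z = c * g.dCoord x v w z := by
  rw [dCoord, ContinuousLinearMap.map_smul, ContinuousLinearMap.map_smul]
  rfl

lemma dCoord_smul₃ (x : M) (c : ℝ) (v w z : TangentSpace I x) :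
    g.dCoord x v w (c • z) = c * g.dCoord x v w z := by
  rw [dCoord, ContinuousLinearMap.map_smul, ContinuousLinearMap.map_smul]
  rfl

/-- The Christoffel symbols of the first kind
`Γ(v, w; z) = (∂_v g(w, z) + ∂_w g(v, z) - ∂_z g(v, w)) / 2` in the chart at `x`. -/
def christoffelLower (x : M) (v w : TangentSpace I x) : Module.Dual ℝ (TangentSpace I x) where
  toFun z := (g.dCoord x v w z + g.dCoord x w v z - g.dCoord x z v w) / 2
  map_add' z z' := by simp only [dCoord_add₁, dCoord_add₃]; ring
  map_smul' c z := by
    simp only [dCoord_smul₁, dCoord_smul₃, RingHom.id_apply, smul_eq_mul]; ring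

/-- The Christoffel symbols of the second kind: `g(Γ(v, w), z) = Γ(v, w; z)`. -/
def christoffel (x : M) :
    TangentSpace I x →ₗ[ℝ] TangentSpace I x →ₗ[ℝ] TangentSpace I x :=
  LinearMap.mk₂ ℝ (fun v w ↦ (g.flat x).symm (g.christoffelLower x v w))
    (fun v v' w ↦ by
      rw [← map_add]
      congr 1
      ext z
      simp only [christoffelLower, LinearMap.coe_mk, AddHom.coe_mk, LinearMap.add_apply,
        dCoord_add₁, dCoord_add₂]
      ring)
    (fun c v w ↦ by
      rw [← map_smul]
      congr 1
      ext z
      simp only [christoffelLower, LinearMap.coe_mk, AddHom.coe_mk, LinearMap.smul_apply,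
        dCoord_smul₁, dCoord_smul₂, smul_eq_mul]
      ring)
    (fun v w w' ↦ by
      rw [← map_add]
      congr 1
      ext z
      simp only [christoffelLower, LinearMap.coe_mk, AddHom.coe_mk, LinearMap.add_apply,
        dCoord_add₁, dCoord_add₂, dCoord_add₃]
      ring)
    (fun c v w ↦ by
      rw [← map_smul]
      congr 1
      ext z
      simp only [christoffelLower, LinearMap.coe_mk, AddHom.coe_mk, LinearMap.smul_apply,
        dCoord_smul₁, dCoord_smul₂, dCoord_smul₃, smul_eq_mul]
      ring)

lemma mdifferentiableAt_coordVec {σ : Π x : M, TangentSpace I x} {x : M} (hσ : MDiffAt (T% σ) x) :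
    MDiffAt (fun y ↦ coordVec I x y (σ y)) x := by
  refine ((mdifferentiableAt_section I σ).1 hσ).congr_of_eventuallyEq ?_
  filter_upwards [(trivializationAt E (TangentSpace I) x).open_baseSet.mem_nhds
    (FiberBundle.mem_baseSet_trivializationAt' x)] with y hy
  rw [coordVec, Trivialization.continuousLinearMapAt_apply, Trivialization.linearMapAt_apply,
    if_pos hy]

lemma ofCoordVec_coordVec (x : M) (v : TangentSpace I x) :
    ofCoordVec I x x (coordVec I x x v) = v :=
  (trivializationAt E (TangentSpace I) x).symmL_continuousLinearMapAt
    (FiberBundle.mem_baseSet_trivializationAt' x) v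

/-- The Levi-Civita connection, `∇_v σ = ∂_v σ + Γ(v, σ)` in the chart at the given point; here
`g.leviCivita σ x v` is `(∇_v σ)(x)`. It is the metric connection without torsion, see
`leviCivita_metric` and `leviCivita_torsion`. -/
def leviCivita : CovariantDerivative I E (TangentSpace I : M → Type _) where
  toFun σ x := ofCoordVec I x x ∘L mvfderiv I (fun y ↦ coordVec I x y (σ y)) x
    + LinearMap.toContinuousLinearMap ((g.christoffel x).flip (σ x))
  isCovariantDerivativeOnUniv :=
    { add := by
        intro σ σ' x hσ hσ' _
        ext v
        have h := mvfderiv_add (mdifferentiableAt_coordVec hσ) (mdifferentiableAt_coordVec hσ')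
        have e : (fun y ↦ coordVec I x y ((σ + σ') y)) =
          (fun y ↦ coordVec I x y (σ y)) + (fun y ↦ coordVec I x y (σ' y)) := by
          ext y; simp
        rw [e, h]
        simp
        abel
      leibniz := by
        intro σ f x hσ hf _
        ext v
        have h := mvfderiv_smul hf (mdifferentiableAt_coordVec hσ)
        have e : (fun y ↦ coordVec I x y ((f • σ) y)) =
          f • (fun y ↦ coordVec I x y (σ y)) := by
          ext y; simp
        rw [e, h]
        simp [ofCoordVec_coordVec]
        module }

lemma mdifferentiableAt_coord (x : M) : MDiffAt (fun y ↦ g.coord x y) x :=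
  ((contMDiff_form_iff _ x).1 (g.contMDiff x)).mdifferentiableAt (by simp)

lemma coord_symm (x y : M) (a b : E) : g.coord x y a b = g.coord x y b a := g.symm _ _ _

lemma coord_coordVec {x y : M} (hy : y ∈ (trivializationAt E (TangentSpace I) x).baseSet)
    (v w : TangentSpace I y) : g.coord x y (coordVec I x y v) (coordVec I x y w) = g.inner y v w := by
  have h : ∀ v : TangentSpace I y, ofCoordVec I x y (coordVec I x y v) = v := fun v ↦
    (trivializationAt E (TangentSpace I) x).symmL_continuousLinearMapAt hy v
  change g.inner y (ofCoordVec I x y (coordVec I x y v)) (ofCoordVec I x y (coordVec I x y w)) = _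
  rw [h, h]

lemma dCoord_symm (x : M) (v w z : TangentSpace I x) : g.dCoord x v w z = g.dCoord x v z w := by
  have h : ∀ a b : E, mvfderiv I (g.coord x) x v a b = mvfderiv I (g.coord x) x v b a := by
    intro a b
    have hd : ∀ a b : E, mvfderiv I (fun y ↦ g.coord x y a b) x v =
        mvfderiv I (g.coord x) x v a b := by
      intro a b
      have h1 := (g.mdifferentiableAt_coord x).hasMFDerivAt
      have h4 : HasMFDerivAt I 𝓘(ℝ, ℝ) (fun y ↦ g.coord x y a b) x _ :=
        ⟨(h1.1.clm_apply continuousAt_const).clm_apply continuousAt_const,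
          (h1.2.clm_apply (hasFDerivWithinAt_const a _ _)).clm_apply
            (hasFDerivWithinAt_const b _ _)⟩
      refine (DFunLike.congr_fun h4.mfderiv v).trans ?_
      simp
      rfl
    rw [← hd, ← hd]
    simp only [g.coord_symm x _ a b]
  exact h _ _

lemma christoffel_symm (x : M) (v w : TangentSpace I x) :
    g.christoffel x v w = g.christoffel x w v := by
  simp only [christoffel, LinearMap.mk₂_apply]
  congr 1
  ext z
  simp only [christoffelLower, LinearMap.coe_mk, AddHom.coe_mk]
  rw [g.dCoord_symm x z v w]; ring

lemma inner_christoffel (x : M) (v w z : TangentSpace I x) : g.inner x (g.christoffel x v w) z =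
   (g.dCoord x v w z + g.dCoord x w v z - g.dCoord x z v w) / 2 := by
  simp only [christoffel, LinearMap.mk₂_apply, inner_flat_symm]
  rfl

/-- The connection `leviCivita` is compatible with the metric. -/
theorem leviCivita_metric {σ τ : Π x : M, TangentSpace I x} {x : M} (hσ : MDiffAt (T% σ) x)
    (hτ : MDiffAt (T% τ) x) (v : TangentSpace I x) :
    mvfderiv I (fun y ↦ g.inner y (σ y) (τ y)) x v =
      g.inner x (g.leviCivita σ x v) (τ x) + g.inner x (σ x) (g.leviCivita τ x v) := by
  have hx := FiberBundle.mem_baseSet_trivializationAt' (F := E) (E := (TangentSpace I : M → Type _)) x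
  have e : (fun y ↦ g.inner y (σ y) (τ y)) =ᶠ[nhds x]
     (fun y ↦ g.coord x y (coordVec I x y (σ y)) (coordVec I x y (τ y))) := by
    filter_upwards [(trivializationAt E (TangentSpace I) x).open_baseSet.mem_nhds hx] with y hy
    exact (g.coord_coordVec hy _ _).symm
  have h1 := (g.mdifferentiableAt_coord x).hasMFDerivAt
  have h2 := (mdifferentiableAt_coordVec hσ).hasMFDerivAt
  have h3 := (mdifferentiableAt_coordVec hτ).hasMFDerivAt
  have h4 : HasMFDerivAt I 𝓘(ℝ, ℝ)
     (fun y ↦ g.coord x y (coordVec I x y (σ y)) (coordVec I x y (τ y))) x _ :=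
    ⟨(h1.1.clm_apply h2.1).clm_apply h3.1, (h1.2.clm_apply h2.2).clm_apply h3.2⟩
  have h5 := DFunLike.congr_fun ((h4.congr_of_eventuallyEq e).mfderiv) v
  have h6 : ∀ (σ : Π x : M, TangentSpace I x), g.leviCivita σ x v =
     ofCoordVec I x x (mvfderiv I (fun y ↦ coordVec I x y (σ y)) x v) + g.christoffel x v (σ x) :=
    fun _ ↦ rfl
  rw [h6, h6]
  rw [map_add, map_add, _root_.add_apply, g.symm x (σ x) (g.christoffel _ _ _),
    inner_christoffel, inner_christoffel]
  have h7 : mvfderiv I (fun y ↦ g.inner y (σ y) (τ y)) x v =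
     g.dCoord x v (σ x) (τ x) + g.coord x x (mvfderiv I (fun y ↦ coordVec I x y (σ y)) x v)
       (coordVec I x x (τ x)) + g.coord x x (coordVec I x x (σ x))
         (mvfderiv I (fun y ↦ coordVec I x y (τ y)) x v) := by
    refine h5.trans ?_
    have hp := extChartAt_to_inv (I := I) x
    set p := (extChartAt I x).symm (extChartAt I x x) with hpdef
    change g.coord x p (coordVec I x p (σ p)) (mvfderiv I (fun y ↦ coordVec I x y (τ y)) x v) +
      (g.coord x p (mvfderiv I (fun y ↦ coordVec I x y (σ y)) x v) (coordVec I x p (τ p)) +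
       mvfderiv I (g.coord x) x v (coordVec I x p (σ p)) (coordVec I x p (τ p))) = _
    rw [hp, dCoord]
    ring
  have h8 : ∀ a b, g.coord x x a (coordVec I x x b) = g.inner x (ofCoordVec I x x a) b := by
    intro a b
    change g.inner x (ofCoordVec I x x a) (ofCoordVec I x x (coordVec I x x b)) = _
    rw [ofCoordVec_coordVec]
  rw [h7, g.coord_symm x x (coordVec I x x (σ x)), h8, h8, g.dCoord_symm x v (τ x) (σ x),
    g.dCoord_symm x (τ x) v (σ x),  g.symm x (σ x) (ofCoordVec I x x _),
    g.dCoord_symm x (σ x) v (τ x)]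
  ring


lemma extend_eq_ofCoordVec {x y : M} (hy : y ∈ (trivializationAt E (TangentSpace I) x).baseSet)
   (v : TangentSpace I x) : FiberBundle.extend E v y = ofCoordVec I x y (coordVec I x x v) := by
  have hx := FiberBundle.mem_baseSet_trivializationAt' (F := E) (E := (TangentSpace I : M → Type _)) x
  simp only [FiberBundle.extend, ofCoordVec, coordVec]
  rw [Trivialization.symmL_apply, Trivialization.continuousLinearMapAt_apply, Trivialization.linearMapAt_apply,
    if_pos hx]
  exact hy

lemma leviCivita_extend (x : M) (v w : TangentSpace I x) : g.leviCivita (FiberBundle.extend E w) x v =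
    g.christoffel x v w := by
  have hx := FiberBundle.mem_baseSet_trivializationAt' (F := E) (E := (TangentSpace I : M → Type _)) x
  have h6 : ∀ (σ : Π x : M, TangentSpace I x), g.leviCivita σ x v =
     ofCoordVec I x x (mvfderiv I (fun y ↦ coordVec I x y (σ y)) x v) + g.christoffel x v (σ x) :=
    fun _ ↦ rfl
  rw [h6, FiberBundle.extend_apply_self]
  have : (fun y ↦ coordVec I x y (FiberBundle.extend E w y)) =ᶠ[nhds x] fun _ ↦ coordVec I x x w := by
    filter_upwards [(trivializationAt E (TangentSpace I) x).open_baseSet.mem_nhds hx] with y hy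
    rw [extend_eq_ofCoordVec hy]
    exact (trivializationAt E (TangentSpace I) x).continuousLinearMapAt_symmL hy _
  have h : mvfderiv I (fun y ↦ coordVec I x y (FiberBundle.extend E w y)) x = 0 := by
    ext v
    have := DFunLike.congr_fun (this.mfderiv_eq (I := I) (I' := 𝓘(ℝ, E))) v
    refine this.trans ?_
    rw [mfderiv_const]
    rfl
  rw [h]
  simp

lemma mlieBracket_extend (x : M) (v w : TangentSpace I x) :
    VectorField.mlieBracket I (FiberBundle.extend E v) (FiberBundle.extend E w) x = 0 := by
  have key : ∀ v : TangentSpace I x,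
     VectorField.mpullbackWithin 𝓘(ℝ, E) I (extChartAt I x).symm (FiberBundle.extend E v) (Set.range I)
       =ᶠ[nhdsWithin (extChartAt I x x) (Set.range I)] fun _ ↦ coordVec I x x v := by
    intro v
    filter_upwards [extChartAt_target_mem_nhdsWithin x] with z hz
    have hs := (extChartAt I x).map_target hz
    have hb : (extChartAt I x).symm z ∈ (trivializationAt E (TangentSpace I) x).baseSet := by
      simpa using hs
    rw [VectorField.mpullbackWithin_apply, extend_eq_ofCoordVec hb]
    have h1 := TangentBundle.symmL_trivializationAt (I := I) (by simpa using hs : (extChartAt I x).symm z ∈ (chartAt H x).source)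
    rw [(extChartAt I x).right_inv hz] at h1
    rw [ofCoordVec, h1]
    exact (isInvertible_mfderivWithin_extChartAt_symm hz).inverse_apply_eq.2 rfl
  rw [VectorField.mlieBracket, VectorField.mlieBracketWithin_apply]
  have : VectorField.lieBracketWithin ℝ (VectorField.mpullbackWithin 𝓘(ℝ, E) I (extChartAt I x).symm (FiberBundle.extend E v) (Set.range I))
    (VectorField.mpullbackWithin 𝓘(ℝ, E) I (extChartAt I x).symm (FiberBundle.extend E w) (Set.range I))
     ((extChartAt I x).symm ⁻¹' Set.univ ∩ Set.range I) (extChartAt I x x) = 0 := by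
    simp only [Set.preimage_univ, Set.univ_inter]
    rw [Filter.EventuallyEq.lieBracketWithin_vectorField_eq_of_mem (key v) (key w) (by simp)]
    simp [VectorField.lieBracketWithin]
  rw [this]
  exact map_zero _

/-- The connection `leviCivita` is torsion-free. -/
theorem leviCivita_torsion : g.leviCivita.torsion = 0 := by
  ext x v w
  rw [CovariantDerivative.torsion_apply_eq_extend]
  rw [mlieBracket_extend, FiberBundle.extend_apply_self, FiberBundle.extend_apply_self,
    leviCivita_extend, leviCivita_extend, christoffel_symm]
  simp

/-- The gradient of a function: `g(grad u, ·) = du`. -/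
def grad (u : M → ℝ) (x : M) : TangentSpace I x :=
  (g.flat x).symm (mvfderiv I u x).toLinearMap

/-- The covariant derivative of a one-form, `(∇_v θ)(Y) = v(θ(Y)) - θ(∇_v Y)`. -/
def covDerivOneForm (θ : Π x : M, TangentSpace I x →L[ℝ] ℝ) (Y : Π x : M, TangentSpace I x)
    (x : M) (v : TangentSpace I x) : ℝ :=
  mvfderiv I (fun y ↦ θ y (Y y)) x v - θ x (g.leviCivita Y x v)

/-- The Hessian `∇du` of `u`, that is `(∇_v du)(Y)`, at `x`. -/
def hessian (u : M → ℝ) (Y : Π x : M, TangentSpace I x) (x : M) (v : TangentSpace I x) : ℝ :=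
  g.covDerivOneForm (fun y ↦ mvfderiv I u y) Y x v

/-- A vector field is parallel if its covariant derivative for the Levi-Civita connection
vanishes. -/
def IsParallel (V : Π x : M, TangentSpace I x) : Prop :=
  ∀ x : M, g.leviCivita V x = 0

end SemiRiemannianMetric

end General

section Cone

/-- The open set of positive real numbers. -/
def posReal : TopologicalSpace.Opens ℝ := ⟨Set.Ioi 0, isOpen_Ioi⟩

variable {E : Type*} [NormedAddCommGroup E] [NormedSpace ℝ E]
  {H : Type*} [TopologicalSpace H] {I : ModelWithCorners ℝ E H}
  {M : Type*} [TopologicalSpace M] [ChartedSpace H M] [IsManifold I ∞ M]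

variable (M) in
/-- The manifold `ℝ_{>0} × M`. -/
abbrev Cone : Type _ := posReal × M

variable (I) in
/-- The model with corners of `ℝ_{>0} × M`. -/
abbrev coneModel : ModelWithCorners ℝ (ℝ × E) (ModelProd ℝ H) := 𝓘(ℝ, ℝ).prod I

variable (I) in
/-- The radial vector field `∂_r`. -/
def radialField (q : Cone M) : TangentSpace (coneModel I) q := ((1 : ℝ), (0 : E))

/-- The vector at `(r, p)` tangent to `{r} × M` given by a tangent vector `v` of `M` at `p`. -/
def horizontalLift (q : Cone M) (v : TangentSpace I q.2) : TangentSpace (coneModel I) q :=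
  ((0 : ℝ), (v : E))

variable (I) in
/-- The differential of the function `r` on the cone, see `mfderiv_radius`. -/
def dRadius (q : Cone M) : TangentSpace (coneModel I) q →L[ℝ] ℝ := ContinuousLinearMap.fst ℝ ℝ E

variable (I) in
/-- The differential of the projection to `M`, see `mfderiv_proj`. -/
def dProj (q : Cone M) : TangentSpace (coneModel I) q →L[ℝ] TangentSpace I q.2 :=
  ContinuousLinearMap.snd ℝ ℝ E

lemma hasMFDerivAt_posReal_val (r : posReal) :
    HasMFDerivAt 𝓘(ℝ, ℝ) 𝓘(ℝ, ℝ) (Subtype.val : posReal → ℝ) r (ContinuousLinearMap.id ℝ ℝ) := by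
  refine ⟨continuous_subtype_val.continuousAt, ?_⟩
  have hmem : (extChartAt 𝓘(ℝ, ℝ) r).target ∈ nhds (extChartAt 𝓘(ℝ, ℝ) r r) :=
    extChartAt_target_mem_nhds r
  refine ((hasFDerivAt_id _).congr_of_eventuallyEq ?_).hasFDerivWithinAt
  filter_upwards [hmem] with t ht
  exact (extChartAt 𝓘(ℝ, ℝ) r).right_inv ht

lemma mfderiv_radius (q : Cone M) :
    mfderiv (coneModel I) 𝓘(ℝ, ℝ) (fun q : Cone M ↦ (q.1 : ℝ)) q = dRadius I q :=
  ((hasMFDerivAt_posReal_val q.1).comp q (hasMFDerivAt_fst q)).mfderiv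

lemma mfderiv_proj (q : Cone M) :
    mfderiv (coneModel I) I (fun q : Cone M ↦ q.2) q = dProj I q :=
  mfderiv_snd

lemma contMDiff_radius :
    ContMDiff (coneModel I) 𝓘(ℝ, ℝ) ∞ (fun q : Cone M ↦ (q.1 : ℝ)) :=
  contMDiff_subtype_val.comp contMDiff_fst

/-- The tensor `ε dr² + r² g`. -/
def coneInner (ε : ℝ) (g : SemiRiemannianMetric I M) (q : Cone M) :
    TangentSpace (coneModel I) q →L[ℝ] TangentSpace (coneModel I) q →L[ℝ] ℝ :=
  ε • (dRadius I q).smulRight (dRadius I q) +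
    (q.1 : ℝ) ^ 2 • ((dProj I q).precomp ℝ ∘L g.inner q.2 ∘L dProj I q)

lemma coneInner_apply (ε : ℝ) (g : SemiRiemannianMetric I M) (q : Cone M)
    (v w : TangentSpace (coneModel I) q) :
    coneInner ε g q v w =
      ε * (dRadius I q v * dRadius I q w) + (q.1 : ℝ) ^ 2 * g.inner q.2 (dProj I q v) (dProj I q w) :=
  rfl

lemma contMDiff_dRadius_sq : ContMDiff (coneModel I)
    ((coneModel I).prod 𝓘(ℝ, (ℝ × E) →L[ℝ] (ℝ × E) →L[ℝ] ℝ)) ∞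
    (fun q ↦ TotalSpace.mk' ((ℝ × E) →L[ℝ] (ℝ × E) →L[ℝ] ℝ)
      (E := fun q : Cone M ↦
        TangentSpace (coneModel I) q →L[ℝ] TangentSpace (coneModel I) q →L[ℝ] ℝ) q
      ((dRadius I q).smulRight (dRadius I q))) := by
  have h := contMDiff_pullback_form (I := 𝓘(ℝ, ℝ)) (M := ℝ) (fun _ ↦ ContinuousLinearMap.mul ℝ ℝ)
    (fun x ↦ (contMDiff_form_iff _ x).2 (by
      refine (contMDiffAt_const (c := ContinuousLinearMap.mul ℝ ℝ)).congr_of_eventuallyEq ?_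
      filter_upwards with y
      ext
      simp only [coordForm, ofCoordVec, TangentBundle.symmL_model_space]
      rfl)) (contMDiff_radius (I := I) (M := M))
  refine h.congr fun q ↦ ?_
  rw [mfderiv_radius]
  rfl

lemma contMDiff_coneInner (ε : ℝ) (g : SemiRiemannianMetric I M) : ContMDiff (coneModel I)
    ((coneModel I).prod 𝓘(ℝ, (ℝ × E) →L[ℝ] (ℝ × E) →L[ℝ] ℝ)) ∞
    (fun q ↦ TotalSpace.mk' ((ℝ × E) →L[ℝ] (ℝ × E) →L[ℝ] ℝ)
      (E := fun q : Cone M ↦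
        TangentSpace (coneModel I) q →L[ℝ] TangentSpace (coneModel I) q →L[ℝ] ℝ) q
      (coneInner ε g q)) := by
  have h := contMDiff_pullback_form g.inner g.contMDiff
    (contMDiff_snd (I := 𝓘(ℝ, ℝ)) (J := I) (M := posReal) (N := M))
  simp only [mfderiv_snd] at h
  intro q
  rw [contMDiff_form_iff]
  have h₁ := (contMDiff_form_iff _ q).1 (contMDiff_dRadius_sq (I := I) (M := M) q)
  have h₂ := (contMDiff_form_iff _ q).1 (h q)
  have h₃ := (contMDiff_radius (I := I) (M := M) q).pow 2
  exact ((contMDiffAt_const (I' := 𝓘(ℝ, ℝ)) (c := ε)).smul h₁).add (h₃.smul h₂)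

/-- The cone metric `ε dr² + r² g` with `ε = ± 1`. -/
def coneMetric (ε : ℝ) (hε : ε = 1 ∨ ε = -1) (g : SemiRiemannianMetric I M) :
    SemiRiemannianMetric (coneModel I) (Cone M) where
  inner := coneInner ε g
  symm q v w := by
    rw [coneInner_apply, coneInner_apply, g.symm, mul_comm (dRadius I q v)]
  nondegenerate q v hv := by
    have hr : (q.1 : ℝ) ^ 2 ≠ 0 := (pow_pos (show (0 : ℝ) < q.1 from q.1.2) 2).ne'
    have hε0 : ε ≠ 0 := by rcases hε with rfl | rfl <;> norm_num
    refine Prod.ext ?_ ?_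
    · have h := hv (radialField I q)
      rw [coneInner_apply] at h
      change ε * ((v : ℝ × E).1 * 1) + (q.1 : ℝ) ^ 2 *
        g.inner q.2 (dProj I q v) (0 : TangentSpace I q.2) = 0 at h
      have h' : (v : ℝ × E).1 = 0 := by simpa [hε0] using h
      exact h'
    · refine g.nondegenerate q.2 _ fun w ↦ ?_
      have h := hv (horizontalLift q w)
      rw [coneInner_apply] at h
      change ε * ((v : ℝ × E).1 * 0) + (q.1 : ℝ) ^ 2 *
        g.inner q.2 (v : ℝ × E).2 w = 0 at h
      have h' : g.inner q.2 (v : ℝ × E).2 w = 0 := by simpa [hr] using h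
      exact h'
  contMDiff := contMDiff_coneInner ε g

end Cone

end

noncomputable section

set_option linter.unusedSectionVars false

variable {E : Type*} [NormedAddCommGroup E] [NormedSpace ℝ E]
  {H : Type*} [TopologicalSpace H] {I : ModelWithCorners ℝ E H}
  {M : Type*} [TopologicalSpace M] [ChartedSpace H M] [IsManifold I ∞ M]

/-- The tangent vector of the cone at `q` with radial component `a` and `M`-component `v`. -/
def coneVec (q : Cone M) (a : ℝ) (v : TangentSpace I q.2) : TangentSpace (coneModel I) q :=
  (a, (v : E))

@[simp] lemma dRadius_coneVec (q : Cone M) (a : ℝ) (v : TangentSpace I q.2) :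
    dRadius I q (coneVec q a v) = a := rfl

@[simp] lemma dProj_coneVec (q : Cone M) (a : ℝ) (v : TangentSpace I q.2) :
    dProj I q (coneVec q a v) = v := rfl

lemma coneVec_eta (q : Cone M) (v : TangentSpace (coneModel I) q) :
    coneVec q (dRadius I q v) (dProj I q v) = v := rfl

lemma coneVec_ext {q : Cone M} {v w : TangentSpace (coneModel I) q}
    (h₁ : dRadius I q v = dRadius I q w) (h₂ : dProj I q v = dProj I q w) : v = w := by
  rw [← coneVec_eta q v, ← coneVec_eta q w, h₁, h₂]

lemma mem_baseSet_cone {q q' : Cone M}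
    (hq : q'.2 ∈ (trivializationAt E (TangentSpace I) q.2).baseSet) :
    q' ∈ (trivializationAt (ℝ × E) (TangentSpace (coneModel I)) q).baseSet := by
  rw [TangentBundle.trivializationAt_baseSet] at hq ⊢
  rw [prodChartedSpace_chartAt]
  refine ⟨?_, hq⟩
  simp only [TopologicalSpace.Opens.chartAt_eq, chartAt_self_eq]
  simp

lemma eventually_mem_baseSet_cone (q : Cone M) :
    ∀ᶠ q' : Cone M in nhds q, q'.2 ∈ (trivializationAt E (TangentSpace I) q.2).baseSet :=
  continuous_snd.continuousAt.eventually_mem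
    ((trivializationAt E (TangentSpace I) q.2).open_baseSet.mem_nhds
      (FiberBundle.mem_baseSet_trivializationAt' q.2))

lemma coordVec_cone {q q' : Cone M}
    (hq : q'.2 ∈ (trivializationAt E (TangentSpace I) q.2).baseSet)
    (v : TangentSpace (coneModel I) q') :
    coordVec (coneModel I) q q' v = (dRadius I q' v, coordVec I q.2 q'.2 (dProj I q' v)) := by
  have hq' := mem_baseSet_cone hq
  rw [TangentBundle.trivializationAt_baseSet] at hq hq'
  rw [coordVec, coordVec, TangentBundle.continuousLinearMapAt_trivializationAt hq',
    TangentBundle.continuousLinearMapAt_trivializationAt hq]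
  have h1 := (hasMFDerivAt_posReal_val q'.1).comp q' (hasMFDerivAt_fst (I := 𝓘(ℝ, ℝ)) (I' := I) q')
  have h2 : HasMFDerivAt I 𝓘(ℝ, E) (extChartAt I q.2) q'.2 _ :=
    (mdifferentiableAt_extChartAt hq).hasMFDerivAt
  have h2' := h2.comp q' (hasMFDerivAt_snd (I := 𝓘(ℝ, ℝ)) q')
  have h3 : HasMFDerivAt (coneModel I) 𝓘(ℝ, ℝ × E)
      (fun x : Cone M ↦ ((Subtype.val ∘ Prod.fst) x, ((extChartAt I q.2) ∘ Prod.snd) x)) q' _ :=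
    ⟨h1.1.prodMk h2'.1, h1.2.prodMk h2'.2⟩
  have h4 : (fun x : Cone M ↦ ((Subtype.val ∘ Prod.fst) x, ((extChartAt I q.2) ∘ Prod.snd) x)) =
     extChartAt (coneModel I) q := by
    rw [extChartAt_prod]; rfl
  rw [← h4]
  exact DFunLike.congr_fun h3.mfderiv v

lemma ofCoordVec_cone {q q' : Cone M}
    (hq : q'.2 ∈ (trivializationAt E (TangentSpace I) q.2).baseSet) (w : ℝ × E) :
    ofCoordVec (coneModel I) q q' w = coneVec q' w.1 (ofCoordVec I q.2 q'.2 w.2) := by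
  have hq' := mem_baseSet_cone hq
  have h : coordVec (coneModel I) q q' (coneVec q' w.1 (ofCoordVec I q.2 q'.2 w.2)) = w := by
    rw [coordVec_cone hq]
    refine Prod.ext rfl ?_
    exact (trivializationAt E (TangentSpace I) q.2).continuousLinearMapAt_symmL hq _
  conv_lhs => rw [← h]
  exact (trivializationAt (ℝ × E) (TangentSpace (coneModel I)) q).symmL_continuousLinearMapAt hq' _

lemma coneMetric_inner_apply (ε : ℝ) (hε : ε = 1 ∨ ε = -1) (g : SemiRiemannianMetric I M)
    (q : Cone M) (v w : TangentSpace (coneModel I) q) :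
    (coneMetric ε hε g).inner q v w = ε * (dRadius I q v * dRadius I q w) +
      (q.1 : ℝ) ^ 2 * g.inner q.2 (dProj I q v) (dProj I q w) :=
  rfl

variable [FiniteDimensional ℝ E] (g : SemiRiemannianMetric I M) (ε : ℝ) (hε : ε = 1 ∨ ε = -1)

lemma coord_cone {q q' : Cone M}
    (hq : q'.2 ∈ (trivializationAt E (TangentSpace I) q.2).baseSet) (w z : ℝ × E) :
    (coneMetric ε hε g).coord q q' w z =
      ε * (w.1 * z.1) + (q'.1 : ℝ) ^ 2 * g.coord q.2 q'.2 w.2 z.2 := by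
  change (coneMetric ε hε g).inner q' (ofCoordVec (coneModel I) q q' w)
    (ofCoordVec (coneModel I) q q' z) = _
  rw [ofCoordVec_cone hq, ofCoordVec_cone hq]
  rfl

namespace SemiRiemannianMetric

lemma hasMFDerivAt_coord_apply (x : M) (a b : E) :
    HasMFDerivAt I 𝓘(ℝ, ℝ) (fun y ↦ g.coord x y a b) x
    ((ContinuousLinearMap.apply ℝ ℝ b ∘L ContinuousLinearMap.apply ℝ (E →L[ℝ] ℝ) a) ∘L
      mvfderiv I (g.coord x) x) := by
  have h : HasMFDerivAt 𝓘(ℝ, E →L[ℝ] E →L[ℝ] ℝ) 𝓘(ℝ, ℝ)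
     (ContinuousLinearMap.apply ℝ ℝ b ∘L ContinuousLinearMap.apply ℝ (E →L[ℝ] ℝ) a) (g.coord x x)
       (ContinuousLinearMap.apply ℝ ℝ b ∘L ContinuousLinearMap.apply ℝ (E →L[ℝ] ℝ) a) :=
    (ContinuousLinearMap.hasFDerivAt _).hasMFDerivAt
  exact h.comp x (g.mdifferentiableAt_coord x).hasMFDerivAt

lemma dCoord_eq (x : M) (v w z : TangentSpace I x) : g.dCoord x v w z =
    mvfderiv I (fun y ↦ g.coord x y (coordVec I x x w) (coordVec I x x z)) x v :=
  (DFunLike.congr_fun (g.hasMFDerivAt_coord_apply x (coordVec I x x w) (coordVec I x x z)).mfderiv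
    v).symm

end SemiRiemannianMetric

lemma dCoord_cone (q : Cone M) (v w z : TangentSpace (coneModel I) q) :
    (coneMetric ε hε g).dCoord q v w z =
      2 * (q.1 : ℝ) * dRadius I q v * g.inner q.2 (dProj I q w) (dProj I q z) +
        (q.1 : ℝ) ^ 2 * g.dCoord q.2 (dProj I q v) (dProj I q w) (dProj I q z) := by
  have hq : q.2 ∈ (trivializationAt E (TangentSpace I) q.2).baseSet :=
    FiberBundle.mem_baseSet_trivializationAt' q.2
  rw [SemiRiemannianMetric.dCoord_eq, coordVec_cone hq, coordVec_cone hq]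
  have h1 := (hasMFDerivAt_posReal_val q.1).comp q (hasMFDerivAt_fst (I := 𝓘(ℝ, ℝ)) (I' := I) q)
  have h2 := (g.hasMFDerivAt_coord_apply q.2 (coordVec I q.2 q.2 (dProj I q w))
    (coordVec I q.2 q.2 (dProj I q z))).comp q (hasMFDerivAt_snd (I := 𝓘(ℝ, ℝ)) q)
  have h3 := (hasMFDerivAt_const (I := coneModel I) (I' := 𝓘(ℝ, ℝ))
    (ε * (dRadius I q w * dRadius I q z)) q).add ((h1.mul h1).mul h2)
  have h4 : (fun y ↦ (coneMetric ε hε g).coord q y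
      (dRadius I q w, coordVec I q.2 q.2 (dProj I q w))
      (dRadius I q z, coordVec I q.2 q.2 (dProj I q z))) =ᶠ[nhds q]
      (fun _ ↦ ε * (dRadius I q w * dRadius I q z)) +
        Subtype.val ∘ Prod.fst * Subtype.val ∘ Prod.fst *
          (fun y ↦ g.coord q.2 y (coordVec I q.2 q.2 (dProj I q w))
            (coordVec I q.2 q.2 (dProj I q z))) ∘ Prod.snd := by
    filter_upwards [eventually_mem_baseSet_cone (I := I) q] with q' hq'
    rw [coord_cone g ε hε hq', pow_two]
    rfl
  refine (DFunLike.congr_fun (h3.congr_of_eventuallyEq h4).mfderiv v).trans ?_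
  change 0 + (((q.1 : ℝ) * (q.1 : ℝ)) * g.dCoord q.2 (dProj I q v) (dProj I q w) (dProj I q z) +
    g.coord q.2 q.2 (coordVec I q.2 q.2 (dProj I q w)) (coordVec I q.2 q.2 (dProj I q z)) *
      ((q.1 : ℝ) * dRadius I q v + (q.1 : ℝ) * dRadius I q v)) = _
  rw [g.coord_coordVec hq]
  ring

lemma christoffel_cone (q : Cone M) (v w : TangentSpace (coneModel I) q) :
    (coneMetric ε hε g).christoffel q v w =
      coneVec q (-ε * (q.1 : ℝ) * g.inner q.2 (dProj I q v) (dProj I q w))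
        (g.christoffel q.2 (dProj I q v) (dProj I q w) +
          (1 / (q.1 : ℝ)) • (dRadius I q v • dProj I q w + dRadius I q w • dProj I q v)) := by
  have hr : (q.1 : ℝ) ≠ 0 := (show (0 : ℝ) < q.1 from q.1.2).ne'
  have hε2 : ε * ε = 1 := by rcases hε with rfl | rfl <;> norm_num
  refine sub_eq_zero.1 ((coneMetric ε hε g).nondegenerate q _ fun z ↦ ?_)
  rw [map_sub, _root_.sub_apply, sub_eq_zero, SemiRiemannianMetric.inner_christoffel,
    dCoord_cone, dCoord_cone, dCoord_cone, coneMetric_inner_apply, dRadius_coneVec, dProj_coneVec,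
    map_add, _root_.add_apply, g.inner_christoffel, map_smul, _root_.smul_apply, map_add,
    _root_.add_apply, map_smul, map_smul, _root_.smul_apply, _root_.smul_apply]
  simp only [smul_eq_mul]
  field_simp
  linear_combination (2 * g.inner q.2 (dProj I q v) (dProj I q w) * dRadius I q z) * hε2

lemma coordVec_eq_trivializationAt {x y : M}
    (hy : y ∈ (trivializationAt E (TangentSpace I) x).baseSet) (v : TangentSpace I y) :
    coordVec I x y v = (trivializationAt E (TangentSpace I) x ⟨y, v⟩).2 := by
  rw [coordVec, Trivialization.continuousLinearMapAt_apply, Trivialization.linearMapAt_apply,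
    if_pos hy]

lemma coordVec_coneVec_eventuallyEq (c : ℝ) (Y : Π x : M, TangentSpace I x) (q : Cone M) :
    (fun q' : Cone M ↦ coordVec (coneModel I) q q' (coneVec q' c (Y q'.2))) =ᶠ[nhds q]
      (fun q' : Cone M ↦ (c, coordVec I q.2 q'.2 (Y q'.2))) := by
  filter_upwards [eventually_mem_baseSet_cone (I := I) q] with q' hq'
  rw [coordVec_cone hq']
  rfl

lemma hasMFDerivAt_coordVec_coneVec (c : ℝ) {Y : Π x : M, TangentSpace I x} {q : Cone M}
    (hY : MDiffAt (T% Y) q.2) :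
    HasMFDerivAt (coneModel I) 𝓘(ℝ, ℝ × E)
      (fun q' : Cone M ↦ coordVec (coneModel I) q q' (coneVec q' c (Y q'.2))) q
      ((0 : TangentSpace (coneModel I) q →L[ℝ] ℝ).prod
        (mvfderiv I (fun y ↦ coordVec I q.2 y (Y y)) q.2 ∘L dProj I q)) := by
  have h1 := (SemiRiemannianMetric.mdifferentiableAt_coordVec hY).hasMFDerivAt.comp q
    (hasMFDerivAt_snd (I := 𝓘(ℝ, ℝ)) q)
  have h2 := hasMFDerivAt_const (I := coneModel I) (I' := 𝓘(ℝ, ℝ)) c q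
  have h3 : HasMFDerivAt (coneModel I) 𝓘(ℝ, ℝ × E)
      (fun q' : Cone M ↦ (c, coordVec I q.2 q'.2 (Y q'.2))) q _ :=
    ⟨h2.1.prodMk h1.1, h2.2.prodMk h1.2⟩
  exact h3.congr_of_eventuallyEq (coordVec_coneVec_eventuallyEq c Y q)

lemma mdifferentiableAt_coneVec (c : ℝ) {Y : Π x : M, TangentSpace I x} {q : Cone M}
    (hY : MDiffAt (T% Y) q.2) : MDifferentiableAt (coneModel I) (coneModel I).tangent
      (fun q' : Cone M ↦ (⟨q', coneVec q' c (Y q'.2)⟩ : TangentBundle (coneModel I) (Cone M)))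
      q := by
  refine (mdifferentiableAt_section (coneModel I) (fun q' : Cone M ↦ coneVec q' c (Y q'.2))).2 ?_
  refine (hasMFDerivAt_coordVec_coneVec c hY).mdifferentiableAt.congr_of_eventuallyEq ?_
  filter_upwards [eventually_mem_baseSet_cone (I := I) q] with q' hq'
  exact (coordVec_eq_trivializationAt (mem_baseSet_cone hq') _).symm

lemma leviCivita_coneVec (c : ℝ) {Y : Π x : M, TangentSpace I x} {q : Cone M}
    (hY : MDiffAt (T% Y) q.2) (v : TangentSpace (coneModel I) q) :
    (coneMetric ε hε g).leviCivita (fun q' : Cone M ↦ coneVec q' c (Y q'.2)) q v =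
      coneVec q (-ε * (q.1 : ℝ) * g.inner q.2 (dProj I q v) (Y q.2))
        (g.leviCivita Y q.2 (dProj I q v) +
          (1 / (q.1 : ℝ)) • (dRadius I q v • Y q.2 + c • dProj I q v)) := by
  have hq : q.2 ∈ (trivializationAt E (TangentSpace I) q.2).baseSet :=
    FiberBundle.mem_baseSet_trivializationAt' q.2
  have h0 : ∀ σ : Π x : Cone M, TangentSpace (coneModel I) x,
      (coneMetric ε hε g).leviCivita σ q v = ofCoordVec (coneModel I) q q
        (mvfderiv (coneModel I) (fun y ↦ coordVec (coneModel I) q y (σ y)) q v) +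
          (coneMetric ε hε g).christoffel q v (σ q) :=
    fun _ ↦ rfl
  have h5 : mvfderiv (coneModel I)
      (fun q' ↦ coordVec (coneModel I) q q' (coneVec q' c (Y q'.2))) q v =
      (0, mvfderiv I (fun y ↦ coordVec I q.2 y (Y y)) q.2 (dProj I q v)) :=
    DFunLike.congr_fun (hasMFDerivAt_coordVec_coneVec c hY).mfderiv v
  have h6 : g.leviCivita Y q.2 (dProj I q v) = ofCoordVec I q.2 q.2
      (mvfderiv I (fun y ↦ coordVec I q.2 y (Y y)) q.2 (dProj I q v)) +
        g.christoffel q.2 (dProj I q v) (Y q.2) := rfl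
  rw [h0, h5, ofCoordVec_cone hq, christoffel_cone, h6, dRadius_coneVec, dProj_coneVec]
  refine coneVec_ext ?_ ?_
  · simp
  · simp [add_assoc]

lemma radialField_eq_coneVec (q : Cone M) : radialField I q = coneVec q 1 0 := rfl

lemma horizontalLift_eq_coneVec (q : Cone M) (v : TangentSpace I q.2) :
    horizontalLift q v = coneVec q 0 v := rfl

lemma leviCivita_radialField (q : Cone M) (v : TangentSpace (coneModel I) q) :
    (coneMetric ε hε g).leviCivita (radialField I) q v =
      coneVec q 0 ((1 / (q.1 : ℝ)) • dProj I q v) := by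
  have h0 : MDiffAt (T% (fun x : M ↦ (0 : TangentSpace I x))) q.2 :=
    (contMDiff_zeroSection ℝ (TangentSpace I : M → Type _)).mdifferentiableAt (n := 1) (by simp)
  refine (leviCivita_coneVec g ε hε 1 h0 v).trans ?_
  have h1 : g.leviCivita (fun x : M ↦ (0 : TangentSpace I x)) q.2 = 0 :=
    congrFun g.leviCivita.zero q.2
  rw [h1]
  refine coneVec_ext ?_ ?_ <;> simp

lemma contMDiff_dRadius_apply {V : Π q : Cone M, TangentSpace (coneModel I) q}
    (hV : ContMDiff (coneModel I) (coneModel I).tangent ∞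
      (fun q ↦ (⟨q, V q⟩ : TangentBundle (coneModel I) (Cone M)))) :
    ContMDiff (coneModel I) 𝓘(ℝ, ℝ) ∞ (fun q ↦ dRadius I q (V q)) := by
  intro q
  have h := (contMDiffAt_section (IB := coneModel I) (s := V) q).1 (hV q)
  have h' : ContMDiffAt 𝓘(ℝ, ℝ × E) 𝓘(ℝ, ℝ) ∞ (Prod.fst : ℝ × E → ℝ)
    ((trivializationAt (ℝ × E) (TangentSpace (coneModel I)) q ⟨q, V q⟩).2) :=
      contDiff_fst.contMDiff.contMDiffAt
  refine (h'.comp q h).congr_of_eventuallyEq ?_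
  filter_upwards [eventually_mem_baseSet_cone (I := I) q] with q' hq'
  have := congrArg Prod.fst ((coordVec_eq_trivializationAt (mem_baseSet_cone hq') (V q')).symm.trans
    (coordVec_cone hq' (V q')))
  exact this.symm

lemma SemiRiemannianMetric.mdifferentiableAt_inner {σ τ : Π x : M, TangentSpace I x} {x : M}
    (hσ : MDiffAt (T% σ) x) (hτ : MDiffAt (T% τ) x) :
    MDiffAt (fun y ↦ g.inner y (σ y) (τ y)) x := by
  refine (((g.mdifferentiableAt_coord x).clm_apply (mdifferentiableAt_coordVec hσ)).clm_apply
    (mdifferentiableAt_coordVec hτ)).congr_of_eventuallyEq ?_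
  filter_upwards [(trivializationAt E (TangentSpace I) x).open_baseSet.mem_nhds
    (FiberBundle.mem_baseSet_trivializationAt' x)] with y hy
  exact (g.coord_coordVec hy _ _).symm

lemma SemiRiemannianMetric.inner_grad (u : M → ℝ) (x : M) (w : TangentSpace I x) :
    g.inner x (g.grad u x) w = mvfderiv I u x w :=
  g.inner_flat_symm x _ w

lemma SemiRiemannianMetric.eq_of_inner_eq {x : M} {v w : TangentSpace I x}
    (h : ∀ z, g.inner x v z = g.inner x w z) : v = w :=
  sub_eq_zero.1 (g.nondegenerate x _ fun z ↦ by
    rw [map_sub, _root_.sub_apply, h, sub_self])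

/-- The inclusion of `M` into its cone as the slice of radius `r`. -/
def coneSlice (r : posReal) (p : M) : Cone M := (r, p)

lemma contMDiff_coneSlice (r : posReal) : ContMDiff I (coneModel I) ∞ (coneSlice (M := M) r) :=
  contMDiff_const.prodMk contMDiff_id

lemma mfderiv_coneSlice (r : posReal) (p : M) (v : TangentSpace I p) :
    mfderiv I (coneModel I) (coneSlice r) p v = coneVec (coneSlice r p) 0 v :=
  DFunLike.congr_fun ((hasMFDerivAt_const (I := I) (I' := 𝓘(ℝ, ℝ)) r p).prodMk
    (hasMFDerivAt_id p)).mfderiv v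

lemma eq_of_mvfderiv_radial_eq_zero {f : Cone M → ℝ}
    (hf : MDifferentiable (coneModel I) 𝓘(ℝ, ℝ) f)
    (h : ∀ q, mvfderiv (coneModel I) f q (radialField I q) = 0) (r s : posReal) (p : M) :
    f (r, p) = f (s, p) := by
  let e : ℝ → posReal := fun t ↦ ⟨Real.exp t, Real.exp_pos t⟩
  have he : ∀ t, HasMFDerivAt 𝓘(ℝ, ℝ) 𝓘(ℝ, ℝ) e t
      (ContinuousLinearMap.toSpanSingleton ℝ (Real.exp t)) := fun t ↦
    ⟨(Real.continuous_exp.subtype_mk _).continuousAt,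
      (Real.hasDerivAt_exp t).hasFDerivAt.hasFDerivWithinAt⟩
  have hc : ∀ t, HasMFDerivAt 𝓘(ℝ, ℝ) 𝓘(ℝ, ℝ) (fun t ↦ f (e t, p)) t 0 := by
    intro t
    have h1 := (he t).prodMk (hasMFDerivAt_const (I := 𝓘(ℝ, ℝ)) (I' := I) p t)
    have h2 := (hf (e t, p)).hasMFDerivAt.comp t h1
    refine h2.congr_mfderiv ?_
    ext
    refine Eq.trans ?_ ((congrArg (Real.exp t * ·) (h (e t, p))).trans (mul_zero _))
    refine Eq.trans ?_ ((mvfderiv (coneModel I) f (e t, p)).map_smul (Real.exp t)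
      (radialField I _))
    refine congrArg (mvfderiv (coneModel I) f (e t, p)) ?_
    refine coneVec_ext ?_ ?_
    · change (1 : ℝ) * Real.exp t = Real.exp t * 1
      ring
    · exact (smul_zero (Real.exp t)).symm
  have hd : ∀ t, HasFDerivAt (fun t ↦ f (e t, p)) (0 : ℝ →L[ℝ] ℝ) t := fun t ↦ (hc t).hasFDerivAt
  have hk := is_const_of_fderiv_eq_zero (𝕜 := ℝ) (fun t ↦ (hd t).differentiableAt)
    (fun t ↦ (hd t).fderiv) (Real.log r) (Real.log s)
  have hl : ∀ r : posReal, e (Real.log r) = r := fun r ↦ Subtype.ext (Real.exp_log r.2)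
  simpa only [hl] using hk

end

theorem mainTheorem7
    {E : Type*} [NormedAddCommGroup E] [NormedSpace ℝ E] [FiniteDimensional ℝ E]
    {H : Type*} [TopologicalSpace H] {I : ModelWithCorners ℝ E H}
    {M : Type*} [TopologicalSpace M] [ChartedSpace H M] [IsManifold I ∞ M]
    [BoundarylessManifold I M]
    (g : SemiRiemannianMetric I M) (ε : ℝ) (hε : ε = 1 ∨ ε = -1)
    (V : Π q : Cone M, TangentSpace (coneModel I) q)
    (hV : ContMDiff (coneModel I) (coneModel I).tangent ∞
      (fun q ↦ (⟨q, V q⟩ : TangentBundle (coneModel I) (Cone M))))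
    (hpar : (coneMetric ε hε g).IsParallel V) :
    ∃ u : M → ℝ, ContMDiff I 𝓘(ℝ, ℝ) ∞ u ∧
      (∀ q : Cone M, (coneMetric ε hε g).inner q (V q) (radialField I q) = u q.2) ∧
      (∀ q : Cone M, V q = (ε * u q.2) • radialField I q +
        (1 / (q.1 : ℝ)) • horizontalLift q (g.grad u q.2)) ∧
      (∀ (p : M) (X : TangentSpace I p) (Y : Π x : M, TangentSpace I x), MDiffAt (T% Y) p →
        g.hessian u Y p X = -ε * u p * g.inner p X (Y p)) := by
  set G := coneMetric ε hε g
  have hVd : ∀ q, MDifferentiableAt (coneModel I) (coneModel I).tangent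
      (fun q ↦ (⟨q, V q⟩ : TangentBundle (coneModel I) (Cone M))) q := fun q ↦
    (hV q).mdifferentiableAt (by simp)
  have hε2 : ε * ε = 1 := by rcases hε with rfl | rfl <;> norm_num
  have hderiv : ∀ (W : Π q : Cone M, TangentSpace (coneModel I) q) (q : Cone M),
      MDifferentiableAt (coneModel I) (coneModel I).tangent
        (fun q ↦ (⟨q, W q⟩ : TangentBundle (coneModel I) (Cone M))) q → ∀ v,
      mvfderiv (coneModel I) (fun q ↦ G.inner q (V q) (W q)) q v =
        G.inner q (V q) (G.leviCivita W q v) := by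
    intro W q hW v
    rw [G.leviCivita_metric (hVd q) hW, hpar q, _root_.zero_apply, map_zero, _root_.zero_apply,
      zero_add]
  let f : Cone M → ℝ := fun q ↦ G.inner q (V q) (radialField I q)
  have hf_apply : ∀ q, f q = ε * dRadius I q (V q) := by
    intro q
    change G.inner q (V q) (radialField I q) = _
    rw [coneMetric_inner_apply, radialField_eq_coneVec, dRadius_coneVec, dProj_coneVec, map_zero]
    ring
  have hf : ContMDiff (coneModel I) 𝓘(ℝ, ℝ) ∞ f :=
    (contMDiff_const.mul (contMDiff_dRadius_apply hV)).congr hf_apply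
  have hrad : ∀ q : Cone M, MDifferentiableAt (coneModel I) (coneModel I).tangent
      (fun q ↦ (⟨q, radialField I q⟩ : TangentBundle (coneModel I) (Cone M))) q := fun q ↦
    mdifferentiableAt_coneVec 1
      ((contMDiff_zeroSection ℝ (TangentSpace I : M → Type _)).mdifferentiableAt (n := 1) (by simp))
  have hdf : ∀ q v, mvfderiv (coneModel I) f q v =
      (q.1 : ℝ) * g.inner q.2 (dProj I q (V q)) (dProj I q v) := by
    intro q v
    have hr : (q.1 : ℝ) ≠ 0 := (show (0 : ℝ) < q.1 from q.1.2).ne'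
    rw [hderiv _ q (hrad q), leviCivita_radialField, coneMetric_inner_apply, dRadius_coneVec,
      dProj_coneVec, map_smul, smul_eq_mul]
    field_simp
    ring
  have hfd : MDifferentiable (coneModel I) 𝓘(ℝ, ℝ) f := hf.mdifferentiable (by simp)
  let one : posReal := ⟨1, (one_pos : (0 : ℝ) < 1)⟩
  let u : M → ℝ := f ∘ coneSlice one
  have hfu : ∀ q : Cone M, f q = u q.2 := fun q ↦
    eq_of_mvfderiv_radial_eq_zero hfd
      (fun q ↦ by rw [hdf, radialField_eq_coneVec, dProj_coneVec, map_zero, mul_zero]) q.1 one q.2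
  have hu : ContMDiff I 𝓘(ℝ, ℝ) ∞ u := hf.comp (contMDiff_coneSlice one)
  have hdu : ∀ (q : Cone M) (v : TangentSpace I q.2), mvfderiv I u q.2 v =
      (q.1 : ℝ) * g.inner q.2 (dProj I q (V q)) v := by
    intro q v
    have h := mvfderiv_comp_apply q ((hu q.2).mdifferentiableAt (by simp))
      (mdifferentiableAt_snd (I := 𝓘(ℝ, ℝ))) (coneVec q 0 v)
    rw [mfderiv_snd] at h
    refine h.symm.trans ?_
    rw [show u ∘ Prod.snd = f from (funext hfu).symm, hdf, dProj_coneVec]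
  refine ⟨u, hu, hfu, fun q ↦ ?_, fun p X Y hY ↦ ?_⟩
  · have hr : (q.1 : ℝ) ≠ 0 := (show (0 : ℝ) < q.1 from q.1.2).ne'
    have hgrad : g.grad u q.2 = (q.1 : ℝ) • dProj I q (V q) :=
      g.eq_of_inner_eq fun z ↦ by
        rw [g.inner_grad, hdu, map_smul, _root_.smul_apply, smul_eq_mul]
    rw [hgrad, ← hfu, hf_apply, radialField_eq_coneVec, horizontalLift_eq_coneVec]
    refine coneVec_ext ?_ ?_
    · simp [← mul_assoc, hε2]
    · simp [smul_smul, hr]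
  · have hq : ∀ y, mvfderiv I u y (Y y) =
        ((fun q : Cone M ↦ G.inner q (V q) (coneVec q 0 (Y q.2))) ∘ coneSlice one) y := by
      intro y
      refine (hdu (coneSlice one y) (Y y)).trans ?_
      rw [Function.comp_apply, coneMetric_inner_apply, dRadius_coneVec, dProj_coneVec]
      change (1 : ℝ) * _ = _ + (1 : ℝ) ^ 2 * _
      simp [coneSlice]
    have hW := mdifferentiableAt_coneVec 0 (q := coneSlice one p) hY
    have hd := mvfderiv_comp_apply p (G.mdifferentiableAt_inner (hVd (coneSlice one p)) hW)
      ((contMDiff_coneSlice one p).mdifferentiableAt (by simp)) X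
    rw [SemiRiemannianMetric.hessian, SemiRiemannianMetric.covDerivOneForm, funext hq, hd,
      mfderiv_coneSlice, hderiv _ _ hW, leviCivita_coneVec g ε hε 0 hY, coneMetric_inner_apply]
    have hu1 : u p = ε * dRadius I (coneSlice one p) (V (coneSlice one p)) := hf_apply _
    have hdu1 : mvfderiv I u p (g.leviCivita Y p X) = 1 * g.inner p
      (dProj I (coneSlice one p) (V (coneSlice one p))) (g.leviCivita Y p X) :=
        hdu (coneSlice one p) _
    have h0 : dRadius I (coneSlice one p) (coneVec (coneSlice one p) 0 X) = 0 := rfl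
    rw [hdu1, hu1, h0, zero_smul, zero_smul, add_zero, smul_zero, add_zero]
    change ε * (dRadius I (coneSlice one p) (V (coneSlice one p)) *
      (-ε * 1 * g.inner p X (Y p))) + 1 ^ 2 * g.inner p
        (dProj I (coneSlice one p) (V (coneSlice one p))) (g.leviCivita Y p X) - _ = _
    ring
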